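/- Let $P, S \subseteq \mathbb{R}^2$, and let $X_P, Y_P$ (resp. $X_S, Y_S$) be the sets of $x$-coordinates and of $y$-coordinates of the points of $P$ (resp. $S$). Say that $S$ contains $P$ if there are functions $f_X : X_P \to X_S$ and $f_Y : Y_P \to Y_S$ such that $\frac{f_X(x_0)-f_X(x_1)}{x_0-x_1} \ge 1$ for all $x_0 > x_1$ in $X_P$, $\frac{f_Y(y_0)-f_Y(y_1)}{y_0-y_1} \ge 1$ for all $y_0 > y_1$ in $Y_P$, and $(f_X(x), f_Y(y)) \in S$ for all $(x,y) \in P$; otherwise $S$ is $P$-free. For real $n > 0$ let $\mathrm{px}(n,P)$ be the supremum of the Lebesgue measures of the open $P$-free subsets $S \subseteq [0,n]^2$. Theorem. Let $P \subseteq \mathbb{R}^2$ be open and non-empty, and let $Q_P$ be the set of points of $P$ both of whose coordinates are rational. Then $\mathrm{px}(n, Q_P) = \Theta(n^2)$ and $\mathrm{px}(n, P) = \Theta(n^2)$, where the constant in the lower bound depends on $P$ and the constant in the upper bound does not. Precisely: there is an absolute constant $C > 0$ such that for every non-empty open $P \subseteq \mathbb{R}^2$ there is $c > 0$ (depending on $P$)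 such that for all real $n > 0$ $$c\,n^2 \le \mathrm{px}(n, Q_P) \le C\,n^2 \quad\text{and}\quad c\,n^2 \le \mathrm{px}(n, P) \le C\,n^2 .$$ -/

import Mathlib

open MeasureTheory

/-- `S` contains `P`: there are maps `f : X_P → X_S` and `g : Y_P → Y_S` between the sets of
`x`-coordinates and of `y`-coordinates, all of whose difference quotients are at least `1`,
such that `(f x, g y) ∈ S` for every `(x, y) ∈ P`. -/
def PlaneContains (S P : Set (ℝ × ℝ)) : Prop :=
  ∃ (f : (Prod.fst '' P : Set ℝ) → (Prod.fst '' S : Set ℝ))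
    (g : (Prod.snd '' P : Set ℝ) → (Prod.snd '' S : Set ℝ)),
    (∀ x₀ x₁ : (Prod.fst '' P : Set ℝ), (x₁ : ℝ) < x₀ →
      ((f x₀ : ℝ) - f x₁) / ((x₀ : ℝ) - x₁) ≥ 1) ∧
    (∀ y₀ y₁ : (Prod.snd '' P : Set ℝ), (y₁ : ℝ) < y₀ →
      ((g y₀ : ℝ) - g y₁) / ((y₀ : ℝ) - y₁) ≥ 1) ∧
    ∀ (p : ℝ × ℝ) (hp : p ∈ P),
      ((f ⟨p.1, Set.mem_image_of_mem Prod.fst hp⟩ : ℝ),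
        (g ⟨p.2, Set.mem_image_of_mem Prod.snd hp⟩ : ℝ)) ∈ S

/-- `S` is `P`-free (avoids `P`). -/
def PlaneFree (P S : Set (ℝ × ℝ)) : Prop :=
  ¬ PlaneContains S P

/-- `px n P`: the supremum of the Lebesgue measures of the open `P`-free subsets
of the square `[0, n]²`. -/
noncomputable def px (n : ℝ) (P : Set (ℝ × ℝ)) : ENNReal :=
  sSup {v : ENNReal | ∃ S : Set (ℝ × ℝ),
    IsOpen S ∧ S ⊆ Set.Icc 0 n ×ˢ Set.Icc 0 n ∧ PlaneFree P S ∧ v = volume S}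

/-- The points of `P` both of whose coordinates are rational. -/
def rationalPoints (P : Set (ℝ × ℝ)) : Set (ℝ × ℝ) :=
  {p | p ∈ P ∧ (∃ a : ℚ, (a : ℝ) = p.1) ∧ ∃ b : ℚ, (b : ℝ) = p.2}

/-!
The upper bound is the area of the square `[0, n]²`. For the lower bound, only finitely many
points of `P` matter: an open set contains, for some rational `r > 0` and every `t`, a `t × t` grid
of rational points with spacing `r / t`. Expanding maps send the `t` columns of this grid to reals
that are pairwise at least `r / t` apart, and likewise the rows. Cut `[0, n]²` into `N × N` cells of
side `n / N ≤ r / t`: a copy of the grid then meets `t` distinct columns and `t` distinct rows of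
cells, so a union of open cells containing `P` contains a whole `t × t` subarray of cells.

It therefore suffices to 2-colour the `N × N` cells without a monochromatic `t × t` subarray and to
take the cells of the more frequent colour, which have total area at least `n² / 2`. Such a
colouring exists as soon as `2 * N ^ (2 * t) < 2 ^ (t ^ 2)`, by the counting argument behind the
lower bound for bipartite Ramsey numbers (`exists_coloring_no_mono_subarray`). Since `N` can be
taken to be `M * t` with `M ≥ n / r` fixed, the condition holds for all large `t`
(`exists_two_mul_pow_lt`). In particular the lower constant `1 / 2` works for every `P`.
-/

/-! ### Colourings without monochromatic subarrays -/

/-- The colourings that are constantly `col` on `T` are determined by their values off `T`. -/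
theorem card_filter_eq_on_mul {α : Type*} [Fintype α] [DecidableEq α] (T : Finset α)
    (col : Bool) :
    (Finset.univ.filter fun c : α → Bool => ∀ x ∈ T, c x = col).card * 2 ^ T.card
      = 2 ^ Fintype.card α := by
  have h : (Finset.univ.filter fun c : α → Bool => ∀ x ∈ T, c x = col)
      = Fintype.piFinset fun x => if x ∈ T then {col} else Finset.univ := by
    ext c
    simp only [Finset.mem_filter, Finset.mem_univ, true_and, Fintype.mem_piFinset]
    refine forall_congr' fun x => ?_
    by_cases hx : x ∈ T <;> simp [hx]
  have h2 : ∀ x : α, (if x ∈ T then ({col} : Finset Bool) else Finset.univ).card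
      = if x ∈ T then 1 else 2 := by
    intro x
    by_cases hx : x ∈ T <;> simp [hx]
  rw [h, Fintype.card_piFinset, Finset.prod_congr rfl fun x _ => h2 x, Finset.prod_ite]
  simp only [Finset.prod_const, one_pow, one_mul]
  rw [← pow_add, Finset.filter_not, Finset.filter_univ_mem,
    Finset.card_sdiff_add_card_eq_card (Finset.subset_univ T), Finset.card_univ]

/-- A union bound: each `t × t` subarray is monochromatic for a proportion `2 * 2 ^ (-t ^ 2)` of the
colourings, and there are at most `N ^ (2 * t)` subarrays. -/
theorem exists_coloring_no_mono_subarray {N t : ℕ} (h : 2 * N ^ (2 * t) < 2 ^ (t ^ 2)) :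
    ∃ c : Fin N × Fin N → Bool, ∀ (a b : Fin t → Fin N), a.Injective → b.Injective →
      ∀ col : Bool, ∃ i j, c (a i, b j) ≠ col := by
  classical
  by_contra! hc
  let I : Finset ((Fin t → Fin N) × (Fin t → Fin N) × Bool) :=
    Finset.univ.filter fun p => p.1.Injective ∧ p.2.1.Injective
  let T : (Fin t → Fin N) × (Fin t → Fin N) × Bool → Finset (Fin N × Fin N) :=
    fun p => Finset.univ.image fun q : Fin t × Fin t => (p.1 q.1, p.2.1 q.2)
  let B : (Fin t → Fin N) × (Fin t → Fin N) × Bool → Finset (Fin N × Fin N → Bool) :=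
    fun p => Finset.univ.filter fun c => ∀ x ∈ T p, c x = p.2.2
  have hcover : (Finset.univ : Finset (Fin N × Fin N → Bool)) ⊆ I.biUnion B := by
    intro c _
    obtain ⟨a, b, ha, hb, col, hcol⟩ := hc c
    refine Finset.mem_biUnion.2 ⟨(a, b, col), by simp [I, ha, hb], ?_⟩
    simp only [B, T, Finset.mem_filter, Finset.mem_univ, true_and, Finset.mem_image]
    rintro x ⟨q, rfl⟩
    exact hcol q.1 q.2
  have hT : ∀ p ∈ I, (T p).card = t ^ 2 := by
    intro p hp
    obtain ⟨ha, hb⟩ := (Finset.mem_filter.1 hp).2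
    refine (Finset.card_image_of_injective _ (Function.Injective.prodMap ha hb)).trans ?_
    simp [sq]
  have hI : I.card ≤ 2 * N ^ (2 * t) := by
    refine (Finset.card_le_univ _).trans_eq ?_
    simp only [Fintype.card_prod, Fintype.card_fun, Fintype.card_fin, Fintype.card_bool]
    ring
  have h1 : 2 ^ Fintype.card (Fin N × Fin N) ≤ ∑ p ∈ I, (B p).card := by
    have := (Finset.card_le_card hcover).trans Finset.card_biUnion_le
    simpa using this
  have h2 : (∑ p ∈ I, (B p).card) * 2 ^ (t ^ 2)
      = I.card * 2 ^ Fintype.card (Fin N × Fin N) := by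
    rw [Finset.sum_mul, ← smul_eq_mul, ← Finset.sum_const]
    refine Finset.sum_congr rfl fun p hp => ?_
    rw [← hT p hp]
    exact card_filter_eq_on_mul (T p) p.2.2
  have hpos : 0 < 2 ^ Fintype.card (Fin N × Fin N) := by positivity
  have h3 := Nat.mul_le_mul_right (2 ^ (t ^ 2)) h1
  rw [h2, mul_comm] at h3
  exact absurd (Nat.le_of_mul_le_mul_right h3 hpos) (by omega)

theorem exists_two_mul_pow_lt (M : ℕ) :
    ∃ t : ℕ, 0 < t ∧ 2 * (M * t) ^ (2 * t) < 2 ^ (t ^ 2) := by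
  have h := tendsto_pow_const_div_const_pow_of_one_lt 2 (one_lt_two : (1 : ℝ) < 2)
  have hε : (0 : ℝ) < 1 / (2 * (M : ℝ) ^ 2 + 1) := by positivity
  obtain ⟨t, ht, ht0⟩ :=
    ((h.eventually (gt_mem_nhds hε)).and (Filter.eventually_gt_atTop 0)).exists
  refine ⟨t, ht0, ?_⟩
  have h1 : 2 * (M * t) ^ 2 < 2 ^ t := by
    rw [div_lt_div_iff₀ (by positivity) (by positivity)] at ht
    have : (2 : ℝ) * (M * t) ^ 2 < 2 ^ t := by nlinarith [sq_nonneg (t : ℝ)]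
    exact_mod_cast this
  calc 2 * (M * t) ^ (2 * t) ≤ 2 ^ t * (M * t) ^ (2 * t) :=
        Nat.mul_le_mul_right _ (Nat.le_self_pow ht0.ne' 2)
    _ = (2 * (M * t) ^ 2) ^ t := by rw [pow_mul, ← mul_pow]
    _ < (2 ^ t) ^ t := Nat.pow_lt_pow_left h1 ht0.ne'
    _ = 2 ^ (t ^ 2) := by rw [← pow_mul, sq]

/-! ### Unions of open grid cells -/

/-- The open interval `(k * ε, (k + 1) * ε)`. -/
def gridInterval (ε : ℝ) (k : ℕ) : Set ℝ := Set.Ioo (k * ε) ((k + 1) * ε)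

/-- The union of the open `ε × ε` grid cells with indices in `E`. -/
def cellUnion (ε : ℝ) {N : ℕ} (E : Finset (Fin N × Fin N)) : Set (ℝ × ℝ) :=
  ⋃ p ∈ E, gridInterval ε p.1 ×ˢ gridInterval ε p.2

theorem eq_of_mem_gridInterval {ε x : ℝ} (hε : 0 < ε) {k l : ℕ} (hk : x ∈ gridInterval ε k)
    (hl : x ∈ gridInterval ε l) : k = l := by
  have h1 : (k : ℝ) < l + 1 := lt_of_mul_lt_mul_right (hk.1.trans hl.2) hε.le
  have h2 : (l : ℝ) < k + 1 := lt_of_mul_lt_mul_right (hl.1.trans hk.2) hε.le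
  norm_cast at h1 h2
  omega

theorem sub_lt_of_mem_gridInterval {ε x y : ℝ} {k : ℕ} (hx : x ∈ gridInterval ε k)
    (hy : y ∈ gridInterval ε k) : x - y < ε := by
  have := hx.2
  have := hy.1
  linarith

theorem gridInterval_subset_Icc {ε : ℝ} (hε : 0 ≤ ε) {N : ℕ} (k : Fin N) :
    gridInterval ε k ⊆ Set.Icc 0 (N * ε) := by
  refine fun x hx => ⟨(by positivity : (0 : ℝ) ≤ k * ε).trans hx.1.le, hx.2.le.trans ?_⟩
  have : ((k : ℕ) : ℝ) + 1 ≤ N := by exact_mod_cast k.2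
  gcongr

theorem isOpen_cellUnion (ε : ℝ) {N : ℕ} (E : Finset (Fin N × Fin N)) :
    IsOpen (cellUnion ε E) :=
  isOpen_biUnion fun _ _ => isOpen_Ioo.prod isOpen_Ioo

theorem volume_cellUnion {ε : ℝ} (hε : 0 < ε) {N : ℕ} (E : Finset (Fin N × Fin N)) :
    volume (cellUnion ε E) = ENNReal.ofReal (E.card * ε ^ 2) := by
  have hcell : ∀ k l : ℕ, volume (gridInterval ε k ×ˢ gridInterval ε l)
      = ENNReal.ofReal (ε ^ 2) := by
    intro k l
    rw [Measure.volume_eq_prod, Measure.prod_prod, gridInterval, gridInterval, Real.volume_Ioo,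
      Real.volume_Ioo, ← ENNReal.ofReal_mul (by nlinarith)]
    congr 1
    ring
  rw [cellUnion, measure_biUnion_finset]
  · rw [Finset.sum_congr rfl fun p _ => hcell p.1 p.2, Finset.sum_const, nsmul_eq_mul,
      ENNReal.ofReal_mul (by positivity), ENNReal.ofReal_natCast]
  · intro p _ q _ hpq
    refine Set.disjoint_left.2 fun z hz hz' => hpq ?_
    exact Prod.ext (Fin.ext (eq_of_mem_gridInterval hε hz.1 hz'.1))
      (Fin.ext (eq_of_mem_gridInterval hε hz.2 hz'.2))
  · exact fun _ _ => (isOpen_Ioo.prod isOpen_Ioo).measurableSet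

/-! ### Copies of a finite grid inside a union of cells -/

/-- Points that are pairwise at least `ε` apart lie in different grid intervals. -/
theorem injective_of_mem_gridInterval {ε : ℝ} {N t : ℕ} {x : Fin t → ℝ} {a : Fin t → Fin N}
    (hx : ∀ i j, j < i → ε ≤ x i - x j) (ha : ∀ i, x i ∈ gridInterval ε (a i)) :
    a.Injective := by
  intro i j hij
  by_contra hne
  rcases lt_or_gt_of_ne hne with h | h
  · have := sub_lt_of_mem_gridInterval (hij ▸ ha j) (ha i)
    linarith [hx j i h]
  · have := sub_lt_of_mem_gridInterval (ha i) (hij ▸ ha j)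
    linarith [hx i j h]

/-- If `P` contains a `t × t` grid with spacing at least `ε`, then every union of `ε × ε` cells
containing `P` contains a full `t × t` subarray of cells. -/
theorem exists_subarray_of_planeContains {ε : ℝ} (hε : 0 < ε) {N t : ℕ} (ht : 0 < t)
    {E : Finset (Fin N × Fin N)} {P : Set (ℝ × ℝ)} {x y : Fin t → ℝ}
    (hx : ∀ i j, j < i → ε ≤ x i - x j) (hy : ∀ i j, j < i → ε ≤ y i - y j)
    (hP : ∀ i j, (x i, y j) ∈ P) (hS : PlaneContains (cellUnion ε E) P) :
    ∃ a b : Fin t → Fin N, a.Injective ∧ b.Injective ∧ ∀ i j, (a i, b j) ∈ E := by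
  obtain ⟨f, g, hf, hg, hfg⟩ := hS
  let o : Fin t := ⟨0, ht⟩
  let X : Fin t → (Prod.fst '' P : Set ℝ) := fun i => ⟨x i, (x i, y o), hP i o, rfl⟩
  let Y : Fin t → (Prod.snd '' P : Set ℝ) := fun j => ⟨y j, (x o, y j), hP o j, rfl⟩
  have hcell : ∀ i j, ∃ p ∈ E, (f (X i) : ℝ) ∈ gridInterval ε (p.1 : ℕ) ∧
      (g (Y j) : ℝ) ∈ gridInterval ε (p.2 : ℕ) := by
    intro i j
    have h := hfg _ (hP i j)
    simp only [cellUnion, Set.mem_iUnion] at h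
    obtain ⟨p, hp, h1, h2⟩ := h
    exact ⟨p, hp, h1, h2⟩
  choose p hpE hp1 hp2 using hcell
  refine ⟨fun i => (p i o).1, fun j => (p o j).2, ?_, ?_, ?_⟩
  · refine injective_of_mem_gridInterval (ε := ε) (x := fun i => (f (X i) : ℝ)) ?_
      fun i => hp1 i o
    intro i j hij
    have hsep := hx i j hij
    have h := hf (X i) (X j) (show x j < x i by linarith)
    have h' := (one_le_div (show 0 < x i - x j by linarith)).1 h
    exact hsep.trans h'
  · refine injective_of_mem_gridInterval (ε := ε) (x := fun j => (g (Y j) : ℝ)) ?_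
      fun j => hp2 o j
    intro i j hij
    have hsep := hy i j hij
    have h := hg (Y i) (Y j) (show y j < y i by linarith)
    have h' := (one_le_div (show 0 < y i - y j by linarith)).1 h
    exact hsep.trans h'
  · intro i j
    have h1 : (p i o).1 = (p i j).1 := Fin.ext (eq_of_mem_gridInterval hε (hp1 i o) (hp1 i j))
    have h2 : (p o j).2 = (p i j).2 := Fin.ext (eq_of_mem_gridInterval hε (hp2 o j) (hp2 i j))
    simpa only [h1, h2] using hpE i j

/-! ### Bounds for `px` -/

theorem px_le (n : ℝ) (hn : 0 ≤ n) (P : Set (ℝ × ℝ)) : px n P ≤ ENNReal.ofReal (1 * n ^ 2) := by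
  refine sSup_le ?_
  rintro v ⟨S, _, hS, _, rfl⟩
  refine (measure_mono hS).trans_eq ?_
  rw [Measure.volume_eq_prod, Measure.prod_prod, Real.volume_Icc, sub_zero,
    ← ENNReal.ofReal_mul hn, one_mul, sq]

theorem half_sq_le_px {P : Set (ℝ × ℝ)} {u v r : ℝ} (hr : 0 < r)
    (hP : ∀ a b : ℚ, 0 ≤ a → a ≤ 1 → 0 ≤ b → b ≤ 1 → (u + r * a, v + r * b) ∈ P)
    {n : ℝ} (hn : 0 < n) : ENNReal.ofReal (1 / 2 * n ^ 2) ≤ px n P := by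
  obtain ⟨M, hM⟩ := exists_nat_ge (n / r)
  obtain ⟨t, ht, hMt⟩ := exists_two_mul_pow_lt M
  have hM0 : (0 : ℝ) < M := (div_pos hn hr).trans_le hM
  have htR : (0 : ℝ) < t := by exact_mod_cast ht
  obtain ⟨c, hc⟩ := exists_coloring_no_mono_subarray hMt
  set ε : ℝ := n / (M * t : ℕ) with hεdef
  have hε : 0 < ε := by
    rw [hεdef]
    push_cast
    positivity
  have hNε : ((M * t : ℕ) : ℝ) * ε = n := by
    rw [hεdef]
    push_cast
    field_simp
  -- The cells are no wider than the grid spacing because `M ≥ n / r`.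
  have hεr : ε ≤ r / t := by
    rw [hεdef]
    push_cast
    rw [div_le_div_iff₀ (by positivity) htR]
    rw [div_le_iff₀ hr] at hM
    nlinarith
  obtain ⟨col, hcol⟩ : ∃ col : Bool,
      (M * t) ^ 2 ≤ 2 * (Finset.univ.filter fun p => c p = col).card := by
    have h := Finset.card_filter_add_card_filter_not (s := Finset.univ) (fun p => c p = true)
    simp only [Bool.not_eq_true, Finset.card_univ, Fintype.card_prod, Fintype.card_fin] at h
    by_contra! hlt
    have h1 := hlt true
    have h2 := hlt false
    rw [sq] at h1 h2
    omega
  set E := Finset.univ.filter fun p => c p = col with hE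
  have hfree : PlaneFree P (cellUnion ε E) := by
    intro hS
    have hsep : ∀ w : ℝ, ∀ i j : Fin t, j < i →
        ε ≤ (w + r * ((i : ℚ) / t : ℚ)) - (w + r * ((j : ℚ) / t : ℚ)) := by
      intro w i j hij
      have hij' : ((j : ℕ) : ℝ) + 1 ≤ (i : ℕ) := by exact_mod_cast hij
      refine hεr.trans ?_
      push_cast
      have : (w + r * (((i : ℕ) : ℝ) / t)) - (w + r * (((j : ℕ) : ℝ) / t))
          = r / t * (((i : ℕ) : ℝ) - (j : ℕ)) := by
        field_simp
        ring
      rw [this]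
      exact le_mul_of_one_le_right (by positivity) (by linarith)
    have hle : ∀ i : Fin t, ((i : ℕ) : ℚ) / t ≤ 1 := fun i =>
      div_le_one_of_le₀ (by exact_mod_cast i.2.le) (by positivity)
    obtain ⟨a, b, ha, hb, hab⟩ := exists_subarray_of_planeContains hε ht (hsep u) (hsep v)
      (fun i j => hP _ _ (by positivity) (hle i) (by positivity) (hle j)) hS
    obtain ⟨i, j, hij⟩ := hc a b ha hb col
    exact hij (Finset.mem_filter.1 (hab i j)).2
  have hsub : cellUnion ε E ⊆ Set.Icc 0 n ×ˢ Set.Icc 0 n := by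
    refine Set.iUnion₂_subset fun p _ => ?_
    have h := fun k => gridInterval_subset_Icc hε.le (N := M * t) k
    rw [hNε] at h
    exact Set.prod_mono (h p.1) (h p.2)
  refine le_trans ?_ (le_sSup ⟨_, isOpen_cellUnion ε E, hsub, hfree, rfl⟩)
  rw [volume_cellUnion hε]
  refine ENNReal.ofReal_le_ofReal ?_
  have hcolR : ((M * t : ℕ) : ℝ) ^ 2 ≤ 2 * E.card := by exact_mod_cast hcol
  calc 1 / 2 * n ^ 2 = 1 / 2 * (((M * t : ℕ) : ℝ) ^ 2 * ε ^ 2) := by rw [← mul_pow, hNε]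
    _ ≤ 1 / 2 * (2 * E.card * ε ^ 2) := by gcongr
    _ = E.card * ε ^ 2 := by ring

/-- A non-empty open set in the plane contains a closed square with rational corners. -/
theorem exists_rat_square_subset {P : Set (ℝ × ℝ)} (hP : IsOpen P) (hne : P.Nonempty) :
    ∃ u v r : ℚ, 0 < r ∧ ∀ a b : ℝ, 0 ≤ a → a ≤ 1 → 0 ≤ b → b ≤ 1 →
      ((u : ℝ) + r * a, (v : ℝ) + r * b) ∈ P := by
  obtain ⟨p, hp⟩ := hne
  obtain ⟨δ, hδ, hball⟩ := Metric.isOpen_iff.1 hP p hp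
  obtain ⟨r, hr0, hr⟩ := exists_rat_btwn (half_pos hδ)
  obtain ⟨u, hu1, hu2⟩ := exists_rat_btwn (show p.1 < p.1 + δ / 2 by linarith)
  obtain ⟨v, hv1, hv2⟩ := exists_rat_btwn (show p.2 < p.2 + δ / 2 by linarith)
  refine ⟨u, v, r, by exact_mod_cast hr0, fun a b ha0 ha1 hb0 hb1 => hball ?_⟩
  have ha : (0 : ℝ) ≤ r * a := mul_nonneg hr0.le ha0
  have hb : (0 : ℝ) ≤ r * b := mul_nonneg hr0.le hb0
  have ha' : (r : ℝ) * a ≤ r := mul_le_of_le_one_right hr0.le ha1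
  have hb' : (r : ℝ) * b ≤ r := mul_le_of_le_one_right hr0.le hb1
  rw [Metric.mem_ball, Prod.dist_eq, max_lt_iff, Real.dist_eq, Real.dist_eq, abs_lt, abs_lt]
  refine ⟨⟨?_, ?_⟩, ?_, ?_⟩ <;> dsimp only <;> linarith

theorem mainTheorem4 :
    ∃ C : ℝ, 0 < C ∧
      ∀ P : Set (ℝ × ℝ), IsOpen P → P.Nonempty →
        ∃ c : ℝ, 0 < c ∧ ∀ n : ℝ, 0 < n →
          (ENNReal.ofReal (c * n ^ 2) ≤ px n (rationalPoints P) ∧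
            px n (rationalPoints P) ≤ ENNReal.ofReal (C * n ^ 2)) ∧
          (ENNReal.ofReal (c * n ^ 2) ≤ px n P ∧
            px n P ≤ ENNReal.ofReal (C * n ^ 2)) := by
  refine ⟨1, one_pos, fun P hP hne => ⟨1 / 2, by norm_num, fun n hn => ?_⟩⟩
  obtain ⟨u, v, r, hr, hsq⟩ := exists_rat_square_subset hP hne
  have hmem : ∀ a b : ℚ, 0 ≤ a → a ≤ 1 → 0 ≤ b → b ≤ 1 →
      ((u : ℝ) + r * a, (v : ℝ) + r * b) ∈ rationalPoints P := by
    intro a b ha0 ha1 hb0 hb1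
    refine ⟨hsq a b (by exact_mod_cast ha0) (by exact_mod_cast ha1) (by exact_mod_cast hb0)
      (by exact_mod_cast hb1), ⟨u + r * a, by push_cast; rfl⟩, ⟨v + r * b, by push_cast; rfl⟩⟩
  have hr' : (0 : ℝ) < r := by exact_mod_cast hr
  exact ⟨⟨half_sq_le_px hr' hmem hn, px_le n hn.le _⟩,
    half_sq_le_px hr' (fun a b h1 h2 h3 h4 => (hmem a b h1 h2 h3 h4).1) hn, px_le n hn.le _⟩
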